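/- Let $c_1,c_5,c_7\in\mathbb R$ with $c_1\neq 0$ and $c_5c_7>0$. For $c_2\in\mathbb R$ consider the homogeneous quadratic vector field $X_{c_2}$ on $\mathbb R^3$ $$\begin{aligned} \dot x&=c_5yz-y(-c_1x-c_2y),\\ \dot y&=x(-c_1x-c_2y)-z\Big(-c_7x-\tfrac{c_2(c_5+c_7)}{c_1}y\Big),\\ \dot z&=y\Big(-c_7x-\tfrac{c_2(c_5+c_7)}{c_1}y\Big)-c_5xy, \end{aligned}$$ and the planar system $Y_{c_2}$ $$\begin{aligned} \dot u&=-c_5v+c_1uv+c_2v^2-(c_5+c_7)u^2v-\tfrac{c_2(c_5+c_7)}{c_1}uv^2,\\ \dot v&=-c_7u-\tfrac{c_2(c_5+c_7)}{c_1}v-c_1u^2-c_2uv-(c_5+c_7)uv^2-\tfrac{c_2(c_5+c_7)}{c_1}v^3. \end{aligned}$$ Then: (a) $X_{c_2}$ is tangent to the unit sphere $\mathbb S^2$, and the central projection $\varphi(x,y,z)=(x/(-z),\,y/(-z))$ of the hemisphere $\mathbb S^2\cap\{z<0\}$ onto the tangent plane at $(0,0,-1)$ maps $X_{c_2}$ to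 $Y_{c_2}$ up to a positive rescaling of time: $D\varphi(q)X_{c_2}(q)=-z\,Y_{c_2}(\varphi(q))$ for every $q=(x,y,z)\in\mathbb S^2$ with $z<0$. (b) For every $c_2\in\mathbb R$, the system $Y_{c_2}$ has no limit cycle, that is, no periodic orbit that has a neighbourhood containing no other periodic orbit. (c) $(Y_{c_2})_{c_2\in\mathbb R}$ is a (generalized) rotated family with respect to $c_2$: the singular points of $Y_{c_2}$ do not depend on $c_2$; the determinants $\det\big(Y_\alpha(p),Y_\beta(p)\big)$, for all $\alpha<\beta$ and $p\in\mathbb R^2$, are all $\ge 0$ or all $\le 0$; and for $\alpha<\beta$ this determinant does not vanish identically on any periodic orbit of $Y_\alpha$ or of $Y_\beta$. (d) For $c_2=0$ the point $(-c_7/c_1,0)$ is a center of $Y_0$: it is a singular point, and it has an open neighbourhood which, with the point removed, is filled with periodic orbits surrounding the point. -/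

import Mathlib

open Set Topology

/-- The quadratic homogeneous vector field `(P, Q, R)` on `ℝ³` of the family with parameters
`c₁, c₂, c₅, c₇`, a point being `(x, y, z)`. -/
noncomputable def sphereField (c1 c2 c5 c7 : ℝ) (q : ℝ × ℝ × ℝ) : ℝ × ℝ × ℝ :=
  let x := q.1
  let y := q.2.1
  let z := q.2.2
  (c5 * y * z - y * (-c1 * x - c2 * y),
   x * (-c1 * x - c2 * y) - z * (-c7 * x - c2 * (c5 + c7) / c1 * y),
   y * (-c7 * x - c2 * (c5 + c7) / c1 * y) - c5 * x * y)

/-- The unit sphere `x² + y² + z² = 1` in `ℝ³`. -/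
def unitSphere : Set (ℝ × ℝ × ℝ) :=
  {q | q.1 ^ 2 + q.2.1 ^ 2 + q.2.2 ^ 2 = 1}

/-- Central projection of the half space `z < 0` (in particular of the open southern hemisphere)
from the origin onto the plane `z = -1`, the tangent plane to the sphere at `(0, 0, -1)`, whose
points `(u, v, -1)` are written `(u, v)`. -/
noncomputable def centralProjection (q : ℝ × ℝ × ℝ) : ℝ × ℝ :=
  (q.1 / (-q.2.2), q.2.1 / (-q.2.2))

/-- The planar cubic vector field with parameters `c₁, c₂, c₅, c₇`, a point being `(u, v)`. -/
noncomputable def planarField (c1 c2 c5 c7 : ℝ) (p : ℝ × ℝ) : ℝ × ℝ :=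
  let u := p.1
  let v := p.2
  (-c5 * v + c1 * u * v + c2 * v ^ 2 - (c5 + c7) * u ^ 2 * v
      - c2 * (c5 + c7) / c1 * u * v ^ 2,
   -c7 * u - c2 * (c5 + c7) / c1 * v - c1 * u ^ 2 - c2 * u * v - (c5 + c7) * u * v ^ 2
      - c2 * (c5 + c7) / c1 * v ^ 3)

/-- `Γ` is a periodic orbit of the planar vector field `X`: the image of a nonconstant periodic
solution of `γ' = X(γ)`. -/
def IsPeriodicOrbit (X : ℝ × ℝ → ℝ × ℝ) (Γ : Set (ℝ × ℝ)) : Prop :=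
  ∃ (γ : ℝ → ℝ × ℝ) (T : ℝ), 0 < T ∧ (∀ t, HasDerivAt γ (X (γ t)) t) ∧
    Function.Periodic γ T ∧ (∃ t, γ t ≠ γ 0) ∧ Γ = range γ

/-- A limit cycle is a periodic orbit that is isolated among the periodic orbits: some
neighbourhood of it contains no other periodic orbit. -/
def IsLimitCycle (X : ℝ × ℝ → ℝ × ℝ) (Γ : Set (ℝ × ℝ)) : Prop :=
  IsPeriodicOrbit X Γ ∧
    ∃ U : Set (ℝ × ℝ), IsOpen U ∧ Γ ⊆ U ∧ ∀ Γ', IsPeriodicOrbit X Γ' → Γ' ⊆ U → Γ' = Γ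

/-- The point `p` is surrounded by the closed curve `Γ`: it is not on `Γ`, and its connected
component in the complement of `Γ` is bounded. -/
def Surrounds (Γ : Set (ℝ × ℝ)) (p : ℝ × ℝ) : Prop :=
  p ∉ Γ ∧ Bornology.IsBounded (connectedComponentIn Γᶜ p)

/-- A singular point `p` of `X` is a center if it has an open neighbourhood `U` such that
`U \ {p}` is filled with periodic orbits surrounding `p`. -/
def IsCenter (X : ℝ × ℝ → ℝ × ℝ) (p : ℝ × ℝ) : Prop :=
  X p = 0 ∧ ∃ U : Set (ℝ × ℝ), IsOpen U ∧ p ∈ U ∧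
    ∀ q ∈ U \ {p}, ∃ Γ, IsPeriodicOrbit X Γ ∧ q ∈ Γ ∧ Γ ⊆ U ∧ Surrounds Γ p

/-- The determinant with rows `X(p)` and `Y(p)`. -/
def fieldDet (X Y : ℝ × ℝ → ℝ × ℝ) (p : ℝ × ℝ) : ℝ :=
  (X p).1 * (Y p).2 - (X p).2 * (Y p).1

/-- The family `X α`, `α` in the open interval `I`, is a (generalized) rotated family: the
singular points do not depend on `α`; the determinant of `X α₁`, `X α₂` for `α₁ < α₂` is
everywhere `≥ 0` (or everywhere `≤ 0`, one sign for the whole family); and it does not vanish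
identically on any periodic orbit of `X α₁` or of `X α₂`. -/
def IsRotatedFamily (X : ℝ → ℝ × ℝ → ℝ × ℝ) (I : Set ℝ) : Prop :=
  IsOpen I ∧ I.OrdConnected ∧
  (∀ α ∈ I, ∀ β ∈ I, ∀ p, X α p = 0 ↔ X β p = 0) ∧
  ((∀ α ∈ I, ∀ β ∈ I, α < β → ∀ p, 0 ≤ fieldDet (X α) (X β) p) ∨
   (∀ α ∈ I, ∀ β ∈ I, α < β → ∀ p, fieldDet (X α) (X β) p ≤ 0)) ∧
  (∀ α ∈ I, ∀ β ∈ I, α < β → ∀ Γ, (IsPeriodicOrbit (X α) Γ ∨ IsPeriodicOrbit (X β) Γ) →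
    ∃ p ∈ Γ, fieldDet (X α) (X β) p ≠ 0)

/-! Write `L(u) = (c5 + c7) u² - c1 u + c5` (`lineQuadratic`) and `ρ = 1 + u² + v²`. On a vertical
line where `L` vanishes, `u'` is `v²` times a constant, so such a line is crossed in one direction
only and no periodic orbit meets it (`lineQuadratic_ne_zero_of_periodic`). On the `u`-range of a
periodic orbit one may therefore solve `G' / G = 2 (c5 + c7) u / L`, and then `I = ρ / G(u)` has
logarithmic derivative `-2 c2 c5 (c5 + c7) v² / (c1 L)` along the flow (`hasDerivAt_firstIntegral`).

If `c2 ≠ 0`, this has constant sign and vanishes only for `v = 0`, so `I` cannot return to its value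
and there is no periodic orbit at all. If `c2 = 0`, `I` is a first integral: the periodic orbits are
ovals `v² = k G(u) - 1 - u²` (`isPeriodicOrbit_levelOval`,
`exists_eq_levelOval_of_isPeriodicOrbit`). Lowering `k` slightly gives another oval nearby, so none
is isolated. At `-c7 / c1` the restriction of `I` to the `u`-axis has a strict local minimum, and
the ovals around it make a center.

The remaining claims are algebraic: `c2` enters the field affinely, so the determinant of two
members is `β - α` times a fixed polynomial, which has constant sign. -/

/-! ### Periodic functions, scalar equations and uniqueness of solutions. -/

/-- A monotone periodic function on the line is constant. -/
lemma Monotone.eq_of_periodic {f : ℝ → ℝ} {T : ℝ} (hf : Monotone f) (hT : 0 < T)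
    (hp : Function.Periodic f T) (s t : ℝ) : f s = f t := by
  have key : ∀ s t, f s ≤ f t := by
    intro s t
    obtain ⟨n, hn⟩ := exists_nat_gt ((s - t) / T)
    rw [div_lt_iff₀ hT] at hn
    have h := hp.nat_mul n t
    rw [← h]
    exact hf (by linarith)
  exact le_antisymm (key s t) (key t s)

/-- A periodic function whose derivative does not change sign has zero derivative. -/
lemma deriv_eq_zero_of_periodic {f f' : ℝ → ℝ} {T σ : ℝ} (hT : 0 < T)
    (hp : Function.Periodic f T) (hf : ∀ t, HasDerivAt f (f' t) t) (hσ : σ ≠ 0)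
    (h : ∀ t, 0 ≤ σ * f' t) (t : ℝ) : f' t = 0 := by
  have hd : ∀ t, HasDerivAt (fun t => σ * f t) (σ * f' t) t := fun t => (hf t).const_mul σ
  have hm : Monotone fun t => σ * f t := by
    refine monotone_of_deriv_nonneg (fun t => (hd t).differentiableAt) fun t => ?_
    rw [(hd t).deriv]
    exact h t
  have hc : (fun t => σ * f t) = fun _ => σ * f 0 :=
    funext fun t => hm.eq_of_periodic hT (fun t => by simp [hp t]) t 0
  have h0 : σ * f' t = 0 := by
    have := hd t
    rw [hc] at this
    exact this.unique (hasDerivAt_const _ _)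
  exact (mul_eq_zero.1 h0).resolve_left hσ

/-- A continuous function on the line has a primitive. -/
lemma Continuous.exists_hasDerivAt {f : ℝ → ℝ} (hf : Continuous f) :
    ∃ F : ℝ → ℝ, ∀ x, HasDerivAt F (f x) x :=
  ⟨fun x => ∫ y in (0 : ℝ)..x, f y, fun _ =>
    intervalIntegral.integral_hasDerivAt_right (hf.intervalIntegrable _ _)
      hf.aestronglyMeasurable.stronglyMeasurableAtFilter hf.continuousAt⟩

/-- Periodic solutions of a scalar autonomous equation are stationary. -/
lemma eq_zero_of_periodic_of_autonomous {v q : ℝ → ℝ} {T : ℝ} (hT : 0 < T)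
    (hp : Function.Periodic v T) (hq : Continuous q) (hv : ∀ t, HasDerivAt v (q (v t)) t) (t : ℝ) :
    q (v t) = 0 := by
  obtain ⟨F, hF⟩ := hq.exists_hasDerivAt
  -- A primitive `F` of `q` increases along solutions, at rate `q²`.
  have hd : ∀ t, HasDerivAt (fun t => F (v t)) (q (v t) * q (v t)) t := fun t =>
    (hF (v t)).comp t (hv t)
  have := deriv_eq_zero_of_periodic (σ := 1) hT (fun t => by simp only [hp t]) hd one_ne_zero
    (fun t => by nlinarith [mul_self_nonneg (q (v t))]) t
  exact mul_self_eq_zero.1 this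

/-- A periodic solution of `w' = A w + B` with `B` of constant sign which vanishes somewhere
vanishes everywhere. -/
lemma eq_zero_of_periodic_of_linear {w A B : ℝ → ℝ} {T σ t₀ : ℝ} (hT : 0 < T)
    (hp : Function.Periodic w T) (hA : Continuous A) (hσ : σ ≠ 0) (hB : ∀ t, 0 ≤ σ * B t)
    (hw : ∀ t, HasDerivAt w (A t * w t + B t) t) (h0 : w t₀ = 0) (t : ℝ) : w t = 0 := by
  obtain ⟨F, hF⟩ := hA.exists_hasDerivAt
  have hd : ∀ t, HasDerivAt (fun t => σ * (w t * Real.exp (-F t))) (σ * B t * Real.exp (-F t)) t := by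
    intro t
    have := ((hw t).mul (hF t).neg.exp).const_mul σ
    exact this.congr_deriv (by simp only [Pi.neg_apply]; ring)
  have hm : Monotone fun t => σ * (w t * Real.exp (-F t)) := by
    refine monotone_of_deriv_nonneg (fun t => (hd t).differentiableAt) fun t => ?_
    rw [(hd t).deriv]
    exact mul_nonneg (hB t) (Real.exp_pos _).le
  have hpos : ∀ t, t₀ ≤ t → 0 ≤ σ * w t := by
    intro t ht
    have := hm ht
    simp only [h0, zero_mul, mul_zero] at this
    rw [← mul_assoc] at this
    exact nonneg_of_mul_nonneg_left this (Real.exp_pos _)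
  have hneg : ∀ t, t ≤ t₀ → σ * w t ≤ 0 := by
    intro t ht
    have := hm ht
    simp only [h0, zero_mul, mul_zero] at this
    rw [← mul_assoc] at this
    exact nonpos_of_mul_nonpos_left this (Real.exp_pos _)
  -- By periodicity the value `w t` is taken both after and before `t₀`, so both sign bounds apply
  -- to it.
  obtain ⟨n, hn⟩ := exists_nat_gt (|t - t₀| / T)
  rw [div_lt_iff₀ hT] at hn
  have h1 := hpos (t + n * T) (by linarith [neg_abs_le (t - t₀)])
  have h2 := hneg (t - n * T) (by linarith [le_abs_self (t - t₀)])
  rw [hp.nat_mul n t] at h1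
  rw [hp.sub_nat_mul_eq n] at h2
  exact (mul_eq_zero.1 (le_antisymm h2 h1)).resolve_left hσ

/-- Two periodic solutions of a `C¹` autonomous equation that meet agree up to a time shift. -/
lemma eq_of_periodic_solutions {E : Type*} [NormedAddCommGroup E] [NormedSpace ℝ E]
    [FiniteDimensional ℝ E] {X : E → E} (hX : ContDiff ℝ 1 X) {γ δ : ℝ → E} {S T : ℝ}
    (hS : 0 < S) (hT : 0 < T) (hγp : Function.Periodic γ S) (hδp : Function.Periodic δ T)
    (hγ : ∀ t, HasDerivAt γ (X (γ t)) t) (hδ : ∀ t, HasDerivAt δ (X (δ t)) t) {a b : ℝ}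
    (h : γ a = δ b) (t : ℝ) : γ (a + t) = δ (b + t) := by
  have hγc : Continuous γ := continuous_iff_continuousAt.2 fun t => (hγ t).continuousAt
  have hδc : Continuous δ := continuous_iff_continuousAt.2 fun t => (hδ t).continuousAt
  -- Both orbits lie in one compact ball, where a `C¹` field is Lipschitz.
  obtain ⟨R, hR⟩ := ((hγp.isBounded_of_continuous hS.ne' hγc).union
    (hδp.isBounded_of_continuous hT.ne' hδc)).subset_closedBall 0
  obtain ⟨K, hK⟩ := hX.contDiffOn.exists_lipschitzOnWith one_ne_zero
    (convex_closedBall (0 : E) R) (isCompact_closedBall 0 R)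
  have := ODE_solution_unique_univ (v := fun _ => X) (s := fun _ => Metric.closedBall 0 R)
    (f := fun t => γ (a + t)) (g := fun t => δ (b + t)) (t₀ := 0) (fun _ => hK)
    (fun t => ⟨HasDerivAt.comp_const_add a t (hγ _), hR (Or.inl (mem_range_self _))⟩)
    (fun t => ⟨HasDerivAt.comp_const_add b t (hδ _), hR (Or.inr (mem_range_self _))⟩) (by simpa using h)
  exact congrFun this t

/-! ### Parametrizing an oval `v² = N(u)` by a periodic solution. -/

/-- Rotation along the circle with a positive continuous angular velocity. -/
lemma exists_angle_solution {Φ : ℝ → ℝ} (hΦ : Continuous Φ) (hpos : ∀ x, 0 < Φ x) {c : ℝ}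
    (hc : 0 < c) (hper : Function.Periodic Φ c) :
    ∃ (θ : ℝ → ℝ) (T : ℝ), 0 < T ∧ (∀ t, HasDerivAt θ (Φ (θ t)) t) ∧ Function.Surjective θ ∧
      ∀ t, θ (t + T) = θ t + c := by
  -- Separation of variables: time as a function of the angle is the primitive `S` of `1 / Φ`, the
  -- solution is its inverse, and the period is `S c`.
  set f : ℝ → ℝ := fun x => (Φ x)⁻¹ with hf
  have hfc : Continuous f := hΦ.inv₀ fun x => (hpos x).ne'
  have hfp : Function.Periodic f c := fun x => by simp [hf, hper x]
  have hf0 : ∀ x, 0 < f x := fun x => inv_pos.2 (hpos x)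
  have hfi : ∀ a b, IntervalIntegrable f MeasureTheory.volume a b := fun a b =>
    hfc.intervalIntegrable a b
  set S : ℝ → ℝ := fun x => ∫ y in (0 : ℝ)..x, f y with hS
  have hSd : ∀ x, HasDerivAt S (f x) x := fun x =>
    intervalIntegral.integral_hasDerivAt_right (hfi _ _)
      hfc.aestronglyMeasurable.stronglyMeasurableAtFilter hfc.continuousAt
  have hSc : Continuous S := continuous_iff_continuousAt.2 fun x => (hSd x).continuousAt
  have hSm : StrictMono S := strictMono_of_deriv_pos fun x => by rw [(hSd x).deriv]; exact hf0 x
  have hSs : Function.Surjective S := hSc.surjective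
    (hfp.tendsto_atTop_intervalIntegral_of_pos' (hfi _ _) hf0 hc)
    (hfp.tendsto_atBot_intervalIntegral_of_pos' (hfi _ _) hf0 hc)
  set e := hSm.orderIsoOfSurjective S hSs
  have he : ∀ t, S (e.symm t) = t := fun t => e.apply_symm_apply t
  refine ⟨e.symm, S c, ?_, fun t => ?_, e.symm.surjective, fun t => ?_⟩
  · have : S 0 = 0 := by simp [hS]
    rw [← this]
    exact hSm hc
  · have := HasDerivAt.of_local_left_inverse (g := e.symm) (a := t)
      e.symm.continuous.continuousAt (hSd _) (hf0 _).ne' (Filter.Eventually.of_forall he)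
    simpa [hf] using this
  · apply hSm.injective
    rw [he]
    have h1 : S (e.symm t + c) = S (e.symm t) + ∫ y in (e.symm t)..(e.symm t + c), f y :=
      (intervalIntegral.integral_add_adjacent_intervals (hfi _ _) (hfi _ _)).symm
    have h2 := hfp.intervalIntegral_add_eq (e.symm t) 0
    rw [h1, h2, he, zero_add]

/-- A product is differentiable at a zero of a differentiable factor, the other factor being merely
continuous. -/
lemma HasDerivAt.mul_continuousAt_of_eq_zero {f g : ℝ → ℝ} {f' x : ℝ} (hf : HasDerivAt f f' x)
    (h0 : f x = 0) (hg : ContinuousAt g x) : HasDerivAt (fun y => f y * g y) (f' * g x) x := by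
  rw [hasDerivAt_iff_tendsto_slope] at hf ⊢
  refine (hf.mul (hg.tendsto.mono_left nhdsWithin_le_nhds)).congr fun y => ?_
  simp only [slope_def_field, h0]
  ring

/-- A function with simple zeros at `a < b` and positive in between is
`(x - a) (b - x) H x` with `H` continuous, and positive on `[a, b]`. -/
lemma exists_factor_of_zeros {N : ℝ → ℝ} (hN : Differentiable ℝ N) {a b : ℝ} (hab : a < b)
    (ha : N a = 0) (hb : N b = 0) (hpos : ∀ x ∈ Ioo a b, 0 < N x) (ha' : 0 < deriv N a)
    (hb' : deriv N b < 0) :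
    ∃ H : ℝ → ℝ, Continuous H ∧ (∀ x ∈ Icc a b, 0 < H x) ∧
      (∀ x, N x = (x - a) * (b - x) * H x) := by
  -- The zeros are divided out by two successive divided differences. As `N` is only differentiable,
  -- the quotient `H` is merely continuous.
  set D := dslope N a with hD
  have hDc : Continuous D := continuous_iff_continuousAt.2 fun x => by
    rcases eq_or_ne x a with rfl | h
    · exact continuousAt_dslope_same.2 (hN x)
    · exact (continuousAt_dslope_of_ne h).2 (hN x).continuousAt
  have hDN : ∀ x, N x = (x - a) * D x := fun x => by
    have := sub_smul_dslope N a x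
    rw [ha, sub_zero, smul_eq_mul] at this
    exact this.symm
  have hDb : D b = 0 := by
    have := hDN b
    rw [hb] at this
    exact (mul_eq_zero.1 this.symm).resolve_left (sub_pos.2 hab).ne'
  have hDd : DifferentiableAt ℝ D b :=
    (differentiableAt_dslope_of_ne hab.ne').2 (hN b)
  set H : ℝ → ℝ := fun x => -dslope D b x with hH
  have hHc : Continuous H := by
    refine Continuous.neg (continuous_iff_continuousAt.2 fun x => ?_)
    rcases eq_or_ne x b with rfl | h
    · exact continuousAt_dslope_same.2 hDd
    · exact (continuousAt_dslope_of_ne h).2 hDc.continuousAt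
  have hDH : ∀ x, D x = (b - x) * H x := fun x => by
    have := sub_smul_dslope D b x
    rw [hDb, sub_zero, smul_eq_mul] at this
    simp only [hH]
    linarith
  have hNH : ∀ x, N x = (x - a) * (b - x) * H x := fun x => by rw [hDN, hDH, mul_assoc]
  refine ⟨H, hHc, fun x hx => ?_, hNH⟩
  rcases eq_or_lt_of_le hx.1 with rfl | hax
  · have h1 := hDH a
    rw [hD, dslope_same] at h1
    rw [h1] at ha'
    exact pos_of_mul_pos_right ha' (sub_pos.2 hab).le
  rcases eq_or_lt_of_le hx.2 with rfl | hxb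
  · have h1 : HasDerivAt N ((x - a) * deriv D x) x := by
      have := ((hasDerivAt_id x).sub_const a).mul hDd.hasDerivAt
      simp only [id, hDb, mul_zero, zero_add] at this
      exact this.congr_of_eventuallyEq (Filter.Eventually.of_forall hDN)
    rw [h1.deriv] at hb'
    have h2 : deriv D x < 0 := neg_of_mul_neg_right hb' (sub_pos.2 hab).le
    simp only [hH, dslope_same]
    linarith
  · have := hpos x ⟨hax, hxb⟩
    rw [hNH] at this
    exact pos_of_mul_pos_right this (mul_pos (sub_pos.2 hax) (sub_pos.2 hxb)).le

/-- A nonvanishing continuous function on a preconnected set has a constant sign. -/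
lemma exists_sign_of_ne_zero {X : Type*} [TopologicalSpace X] {f : X → ℝ} {s : Set X}
    (hs : IsPreconnected s) (hf : ContinuousOn f s) (h0 : ∀ x ∈ s, f x ≠ 0) :
    ∃ ε : ℝ, ε ^ 2 = 1 ∧ ∀ x ∈ s, 0 < ε * f x := by
  rcases s.eq_empty_or_nonempty with rfl | ⟨a, ha⟩
  · exact ⟨1, by norm_num, by simp⟩
  have hsame : ∀ x ∈ s, 0 < f a * f x := by
    intro x hx
    by_contra hneg
    push Not at hneg
    obtain ⟨y, hy, hy0⟩ : (0 : ℝ) ∈ (fun y => f a * f y) '' s :=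
      (hs.image _ (continuousOn_const.mul hf)).ordConnected.out
        (mem_image_of_mem _ hx) (mem_image_of_mem _ ha) ⟨hneg, mul_self_nonneg _⟩
    exact mul_ne_zero (h0 a ha) (h0 y hy) hy0
  rcases lt_or_gt_of_ne (h0 a ha) with h | h
  · exact ⟨-1, by norm_num, fun x hx => by nlinarith [neg_of_mul_pos_right (hsame x hx) h.le]⟩
  · exact ⟨1, by norm_num, fun x hx => by
      rw [one_mul]; exact pos_of_mul_pos_right (hsame x hx) h.le⟩

/-- The closed curve `v² = N u` is a periodic orbit of `u' = -v p(u)`, `v' = -N'(u) p(u) / 2`. -/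
lemma exists_periodic_solution {N p : ℝ → ℝ} (hN : Differentiable ℝ N) (hp : Continuous p)
    {a b : ℝ} (hab : a < b) (ha : N a = 0) (hb : N b = 0) (hpos : ∀ x ∈ Ioo a b, 0 < N x)
    (ha' : 0 < deriv N a) (hb' : deriv N b < 0) (hp0 : ∀ x ∈ Icc a b, p x ≠ 0) :
    ∃ (γ : ℝ → ℝ × ℝ) (T : ℝ), 0 < T ∧ Function.Periodic γ T ∧
      (∀ t, HasDerivAt γ (-(γ t).2 * p (γ t).1, -deriv N (γ t).1 * p (γ t).1 / 2) t) ∧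
      range γ = {q | q.1 ∈ Icc a b ∧ q.2 ^ 2 = N q.1} := by
  obtain ⟨H, hHc, hH0, hNH⟩ := exists_factor_of_zeros hN hab ha hb hpos ha' hb'
  obtain ⟨ε, hε, hεp⟩ := exists_sign_of_ne_zero isPreconnected_Icc hp.continuousOn hp0
  set r := (b - a) / 2 with hr
  have hr0 : 0 < r := by rw [hr]; linarith
  set m := (a + b) / 2 with hm
  -- With this choice `(U - a) (b - U) = (r sin θ)²`, so `r sin θ √H` is a square root of `N(U)`
  -- that changes sign continuously.
  set U : ℝ → ℝ := fun θ => m + r * Real.cos θ with hU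
  have hUm : ∀ θ, U θ ∈ Icc a b := fun θ => by
    have h1 := Real.neg_one_le_cos θ
    have h2 := Real.cos_le_one θ
    simp only [hU, hm, hr]
    constructor <;> nlinarith
  have hUc : Continuous U := by fun_prop
  have hUd : ∀ θ, HasDerivAt U (-(r * Real.sin θ)) θ := fun θ =>
    (((Real.hasDerivAt_cos θ).const_mul r).const_add m).congr_deriv (by ring)
  have hUab : ∀ θ, (U θ - a) * (b - U θ) = (r * Real.sin θ) ^ 2 := fun θ => by
    have := Real.sin_sq_add_cos_sq θ
    have h1 : (U θ - a) * (b - U θ) = r ^ 2 * (1 - Real.cos θ ^ 2) := by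
      simp only [hU, hm, hr]; ring
    rw [h1, mul_pow, ← this]; ring
  set V : ℝ → ℝ := fun θ => ε * r * Real.sin θ * Real.sqrt (H (U θ)) with hV
  have hVc : Continuous V := by fun_prop
  have hVN : ∀ θ, V θ ^ 2 = N (U θ) := fun θ => by
    rw [hNH, hUab]
    simp only [hV, mul_pow, Real.sq_sqrt (hH0 _ (hUm θ)).le, hε]
    ring
  -- This angular velocity is forced by `U' = -V p(U)`; the sign `ε` makes it positive.
  set Φ : ℝ → ℝ := fun θ => ε * p (U θ) * Real.sqrt (H (U θ)) with hΦ
  obtain ⟨θ, T, hT, hθ, hθs, hθT⟩ := exists_angle_solution (Φ := Φ) (by fun_prop)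
    (fun x => mul_pos (hεp _ (hUm x)) (Real.sqrt_pos.2 (hH0 _ (hUm x)))) Real.two_pi_pos
    (fun x => by simp only [hΦ, hU, Real.cos_add_two_pi])
  have hθc : Continuous θ := continuous_iff_continuousAt.2 fun t => (hθ t).continuousAt
  have hu : ∀ t, HasDerivAt (fun t => U (θ t)) (-V (θ t) * p (U (θ t))) t := fun t =>
    ((hUd (θ t)).comp t (hθ t)).congr_deriv (by
      simp only [hΦ, hV]; ring)
  have hv : ∀ t, HasDerivAt (fun t => V (θ t)) (-deriv N (U (θ t)) * p (U (θ t)) / 2) t := by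
    intro t
    have hNu := (hN (U (θ t))).hasDerivAt.comp t (hu t)
    have hVt : ContinuousAt (fun t => V (θ t)) t := (hVc.comp hθc).continuousAt
    -- Where `V ≠ 0`, it is locally `±√N(U)`. Where `V = 0`, the factor `sin θ` vanishes, so
    -- continuity of `√H` suffices for the product rule.
    rcases lt_trichotomy (V (θ t)) 0 with h | h | h
    · have hpt : N (U (θ t)) ≠ 0 := by rw [← hVN]; exact pow_ne_zero 2 h.ne
      have h1 := (hNu.sqrt hpt).neg
      have hs : Real.sqrt (N (U (θ t))) = -V (θ t) := by
        rw [← hVN, Real.sqrt_sq_eq_abs, abs_of_neg h]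
      refine (h1.congr_deriv ?_).congr_of_eventuallyEq ?_
      · have hne := h.ne
        simp only [Function.comp, hs]
        field_simp
      · filter_upwards [hVt.eventually (gt_mem_nhds h)] with x hx
        simp only [Pi.neg_apply, Function.comp]
        rw [← hVN, Real.sqrt_sq_eq_abs, abs_of_neg hx, neg_neg]
    · have hsin : Real.sin (θ t) = 0 := by
        have : ε ≠ 0 := by rintro rfl; norm_num at hε
        have h2 := (Real.sqrt_pos.2 (hH0 _ (hUm (θ t)))).ne'
        simpa [hV, this, hr0.ne', h2] using h
      have h1 : HasDerivAt (fun t => ε * r * Real.sin (θ t))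
          (ε * r * (Real.cos (θ t) * Φ (θ t))) t :=
        ((Real.hasDerivAt_sin _).comp t (hθ t)).const_mul _
      have h2 := h1.mul_continuousAt_of_eq_zero (g := fun t => Real.sqrt (H (U (θ t))))
        (by simp [hsin]) (by fun_prop)
      refine h2.congr_deriv ?_
      have hd : HasDerivAt N ((b + a - 2 * U (θ t)) * H (U (θ t))) (U (θ t)) := by
        have h3 : HasDerivAt (fun x => (x - a) * (b - x)) (b + a - 2 * U (θ t)) (U (θ t)) :=
          (((hasDerivAt_id _).sub_const a).mul ((hasDerivAt_id _).const_sub b)).congr_deriv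
            (by simp only [id]; ring)
        have h4 := h3.mul_continuousAt_of_eq_zero (g := H) (by simp [hUab, hsin])
          hHc.continuousAt
        exact h4.congr_of_eventuallyEq (Filter.Eventually.of_forall hNH)
      rw [hd.deriv]
      have hsq := Real.mul_self_sqrt (hH0 _ (hUm (θ t))).le
      have hUe : b + a - 2 * U (θ t) = -2 * r * Real.cos (θ t) := by
        simp only [hU, hm]; ring
      rw [hUe]
      simp only [hΦ]
      calc _ = ε ^ 2 * r * Real.cos (θ t) * p (U (θ t)) *
            (Real.sqrt (H (U (θ t))) * Real.sqrt (H (U (θ t)))) := by ring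
        _ = _ := by rw [hsq, hε]; ring
    · have hpt : N (U (θ t)) ≠ 0 := by rw [← hVN]; exact pow_ne_zero 2 h.ne'
      have h1 := hNu.sqrt hpt
      have hs : Real.sqrt (N (U (θ t))) = V (θ t) := by
        rw [← hVN, Real.sqrt_sq_eq_abs, abs_of_pos h]
      refine (h1.congr_deriv ?_).congr_of_eventuallyEq ?_
      · simp only [Function.comp, hs]
        field_simp
      · filter_upwards [hVt.eventually (lt_mem_nhds h)] with x hx
        simp only [Function.comp]
        rw [← hVN, Real.sqrt_sq_eq_abs, abs_of_pos hx]
  refine ⟨fun t => (U (θ t), V (θ t)), T, hT, fun t => ?_, fun t => (hu t).prodMk (hv t), ?_⟩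
  · simp only [hθT, hU, hV, Real.cos_add_two_pi, Real.sin_add_two_pi]
  ext ⟨x, y⟩
  simp only [mem_range, Prod.mk.injEq, mem_ofPred_eq]
  constructor
  · rintro ⟨t, rfl, rfl⟩
    exact ⟨hUm _, hVN _⟩
  · rintro ⟨hx, hy⟩
    have hc : ∃ φ, U φ = x := by
      refine ⟨Real.arccos ((x - m) / r), ?_⟩
      simp only [hU]
      rw [Real.cos_arccos, mul_div_cancel₀ _ hr0.ne', add_sub_cancel]
      · rw [le_div_iff₀ hr0, hm, hr]; linarith [hx.1]
      · rw [div_le_iff₀ hr0, hm, hr]; linarith [hx.2]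
    obtain ⟨φ, rfl⟩ := hc
    rw [← hVN, sq_eq_sq_iff_eq_or_eq_neg] at hy
    rcases hy with rfl | rfl
    · obtain ⟨t, rfl⟩ := hθs φ
      exact ⟨t, rfl, rfl⟩
    · obtain ⟨t, ht⟩ := hθs (-φ)
      refine ⟨t, ?_, ?_⟩ <;> simp [ht, hU, hV]

/-! ### Algebra of the planar field. -/

/-- The quadratic polynomial whose zeros are the invariant vertical lines of the planar system
with `c₂ = 0`. -/
noncomputable def lineQuadratic (c1 c5 c7 u : ℝ) : ℝ :=
  (c5 + c7) * u ^ 2 - c1 * u + c5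

@[fun_prop]
lemma continuous_lineQuadratic (c1 c5 c7 : ℝ) : Continuous (lineQuadratic c1 c5 c7) := by
  unfold lineQuadratic
  fun_prop

lemma planarField_fst {c1 : ℝ} (hc1 : c1 ≠ 0) (c2 c5 c7 : ℝ) (q : ℝ × ℝ) :
    (planarField c1 c2 c5 c7 q).1 =
      -q.2 * lineQuadratic c1 c5 c7 q.1 + c2 * q.2 ^ 2 * (1 - (c5 + c7) * q.1 / c1) := by
  simp only [planarField, lineQuadratic]
  field_simp
  ring

lemma contDiff_planarField (c1 c2 c5 c7 : ℝ) : ContDiff ℝ 1 (planarField c1 c2 c5 c7) := by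
  unfold planarField
  fun_prop

/-- The field has the form `Y₀ + c2 Z`, so the determinant is `(β - α) det(Y₀, Z)`. -/
lemma fieldDet_planarField {c1 : ℝ} (hc1 : c1 ≠ 0) (α β c5 c7 : ℝ) (q : ℝ × ℝ) :
    fieldDet (planarField c1 α c5 c7) (planarField c1 β c5 c7) q =
      c5 * (c5 + c7) / c1 * ((β - α) * (q.2 ^ 2 * (1 + q.1 ^ 2 + q.2 ^ 2))) := by
  simp only [fieldDet, planarField]
  field_simp
  ring

lemma planarField_eq_zero_iff {c1 c5 c7 : ℝ} (hc1 : c1 ≠ 0) (hc57 : 0 < c5 * c7) (c2 : ℝ)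
    (q : ℝ × ℝ) :
    planarField c1 c2 c5 c7 q = 0 ↔ q.2 = 0 ∧ q.1 * (c7 + c1 * q.1) = 0 := by
  obtain ⟨u, v⟩ := q
  have hs : c5 * (c5 + c7) ≠ 0 := by nlinarith [mul_self_nonneg c5]
  have hs' : c5 + c7 ≠ 0 := right_ne_zero_of_mul hs
  have hc5 : c5 ≠ 0 := left_ne_zero_of_mul hs
  simp only [Prod.ext_iff, Prod.fst_zero, Prod.snd_zero]
  constructor
  · rintro ⟨h1, h2⟩
    -- The radial combination `u u' + v v'` factors completely.
    have h3 : v * (c1 * u + c2 * v) * ((c5 + c7) * (1 + u ^ 2 + v ^ 2)) = 0 := by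
      have : c1 * (u * (planarField c1 c2 c5 c7 (u, v)).1 +
          v * (planarField c1 c2 c5 c7 (u, v)).2) = 0 := by rw [h1, h2]; ring
      simp only [planarField] at this
      field_simp at this
      linear_combination -this
    have h4 : v * (c1 * u + c2 * v) = 0 :=
      (mul_eq_zero.1 h3).resolve_right (mul_ne_zero hs' (by positivity))
    have hv : v = 0 := by
      -- Apart from `-c5 v`, the first component is a multiple of `v (c1 u + c2 v)`.
      have h5 : c5 * v = 0 := by
        simp only [planarField] at h1
        field_simp at h1
        have : c1 * (c5 * v) = 0 := by linear_combination -h1 + (c1 - (c5 + c7) * u) * h4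
        exact (mul_eq_zero.1 this).resolve_left hc1
      exact (mul_eq_zero.1 h5).resolve_left hc5
    subst hv
    refine ⟨rfl, ?_⟩
    simp only [planarField] at h2
    linear_combination -h2
  · rintro ⟨rfl, h⟩
    simp only [planarField]
    exact ⟨by ring, by linear_combination -h⟩

/-! ### Periodic orbits, the integrating factor, and nonexistence for `c2 ≠ 0`. -/

section Solutions

variable {c1 c2 c5 c7 : ℝ} {γ : ℝ → ℝ × ℝ} {T : ℝ}

lemma HasDerivAt.planar_fst {x : ℝ × ℝ} {t : ℝ} (h : HasDerivAt γ x t) :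
    HasDerivAt (fun t => (γ t).1) x.1 t :=
  (hasFDerivAt_fst (𝕜 := ℝ) (E := ℝ) (F := ℝ)).comp_hasDerivAt t h

lemma HasDerivAt.planar_snd {x : ℝ × ℝ} {t : ℝ} (h : HasDerivAt γ x t) :
    HasDerivAt (fun t => (γ t).2) x.2 t :=
  (hasFDerivAt_snd (𝕜 := ℝ) (E := ℝ) (F := ℝ)).comp_hasDerivAt t h

lemma exists_planarField_ne_zero {X : ℝ × ℝ → ℝ × ℝ} (hγ : ∀ t, HasDerivAt γ (X (γ t)) t)
    (hne : ∃ t, γ t ≠ γ 0) : ∃ t, X (γ t) ≠ 0 := by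
  by_contra h
  push Not at h
  obtain ⟨t, ht⟩ := hne
  exact ht (is_const_of_deriv_eq_zero (fun t => (hγ t).differentiableAt)
    (fun t => by rw [(hγ t).deriv, h t]) t 0)

/-- The first component vanishes on the `u`-axis, so a solution staying there is stationary. -/
lemma exists_snd_ne_zero (hc1 : c1 ≠ 0)
    (hγ : ∀ t, HasDerivAt γ (planarField c1 c2 c5 c7 (γ t)) t) (hne : ∃ t, γ t ≠ γ 0) :
    ∃ t, (γ t).2 ≠ 0 := by
  by_contra h
  push Not at h
  obtain ⟨t, ht⟩ := exists_planarField_ne_zero hγ hne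
  refine ht (Prod.ext ?_ ?_)
  · rw [planarField_fst hc1, h t]
    simp
  · have h1 := (hγ t).planar_snd
    rw [funext h] at h1
    exact h1.unique (hasDerivAt_const t (0 : ℝ))

/-- A periodic orbit passes through no singular point. -/
lemma planarField_ne_zero_of_periodic (hT : 0 < T)
    (hγ : ∀ t, HasDerivAt γ (planarField c1 c2 c5 c7 (γ t)) t) (hp : Function.Periodic γ T)
    (hne : ∃ t, γ t ≠ γ 0) (t : ℝ) : planarField c1 c2 c5 c7 (γ t) ≠ 0 := by
  intro h0
  obtain ⟨s, hs⟩ := exists_planarField_ne_zero hγ hne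
  have := eq_of_periodic_solutions (contDiff_planarField c1 c2 c5 c7) hT hT hp
    (δ := fun _ => γ t) (fun _ => rfl) hγ (fun s => by
      rw [h0]; exact hasDerivAt_const s (γ t)) (a := t) (b := 0) rfl (s - t)
  rw [add_sub_cancel] at this
  exact hs (by rw [this, h0])

/-- A periodic orbit does not meet the vertical lines `lineQuadratic u = 0`. -/
lemma lineQuadratic_ne_zero_of_periodic (hc1 : c1 ≠ 0) (hT : 0 < T)
    (hγ : ∀ t, HasDerivAt γ (planarField c1 c2 c5 c7 (γ t)) t) (hp : Function.Periodic γ T)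
    (hne : ∃ t, γ t ≠ γ 0) (t₀ : ℝ) : lineQuadratic c1 c5 c7 (γ t₀).1 ≠ 0 := by
  intro h0
  set u₀ := (γ t₀).1 with hu₀
  have hγc : Continuous γ := continuous_iff_continuousAt.2 fun t => (hγ t).continuousAt
  -- On the line `u = u₀` one has `u' = κ v²`; `σ` records the sign of `κ`.
  set κ := c2 * (1 - (c5 + c7) * u₀ / c1) with hκ
  obtain ⟨σ, hσ, hσκ⟩ : ∃ σ : ℝ, σ ≠ 0 ∧ 0 ≤ σ * κ := by
    by_cases h : κ = 0
    · exact ⟨1, one_ne_zero, by simp [h]⟩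
    · exact ⟨κ, h, mul_self_nonneg κ⟩
  -- `L(u)` is divisible by `u - u₀`, so `u - u₀` solves a linear equation with forcing term `κ v²`
  -- of constant sign.
  have hw : ∀ t, (γ t).1 - u₀ = 0 := by
    refine eq_zero_of_periodic_of_linear (w := fun t => (γ t).1 - u₀)
      (A := fun t => -(γ t).2 * ((c5 + c7) * ((γ t).1 + u₀) - c1)
        - c2 * (γ t).2 ^ 2 * (c5 + c7) / c1)
      (B := fun t => κ * (γ t).2 ^ 2) (t₀ := t₀) hT (fun t => by simp only [hp t]) (by fun_prop)
      hσ (fun t => by rw [← mul_assoc]; positivity) (fun t => ?_) (sub_self _)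
    refine ((hγ t).planar_fst.sub_const u₀).congr_deriv ?_
    rw [planarField_fst hc1, hκ]
    simp only [lineQuadratic] at h0 ⊢
    field_simp
    linear_combination (-c1 * (γ t).2) * h0
  have hu : ∀ t, (γ t).1 = u₀ := fun t => sub_eq_zero.1 (hw t)
  have hγe : ∀ t, γ t = (u₀, (γ t).2) := fun t => Prod.ext (hu t) rfl
  obtain ⟨t, ht⟩ := exists_planarField_ne_zero hγ hne
  refine ht (Prod.ext ?_ ?_)
  · have h1 := (hγ t).planar_fst
    rw [funext hu] at h1
    exact h1.unique (hasDerivAt_const t u₀)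
  -- An orbit inside a vertical line is governed by a scalar autonomous equation for `v`.
  · rw [hγe t]
    refine eq_zero_of_periodic_of_autonomous (v := fun t => (γ t).2)
      (q := fun v => (planarField c1 c2 c5 c7 (u₀, v)).2) hT (fun t => by simp only [hp t])
      (continuous_snd.comp ((contDiff_planarField c1 c2 c5 c7).continuous.comp (by fun_prop)))
      (fun t => ?_) t
    have h1 := (hγ t).planar_snd
    rw [hγe t] at h1
    exact h1

/-- An integrating factor on an interval without zeros of `lineQuadratic`. -/
lemma exists_integratingFactor {A B : ℝ} (hAB : A ≤ B)
    (h0 : ∀ u ∈ Icc A B, lineQuadratic c1 c5 c7 u ≠ 0) :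
    ∃ G : ℝ → ℝ, (∀ u, 0 < G u) ∧ Differentiable ℝ G ∧ ∀ u ∈ Icc A B,
      HasDerivAt G (2 * (c5 + c7) * u / lineQuadratic c1 c5 c7 u * G u) u := by
  set f : ℝ → ℝ := fun u => 2 * (c5 + c7) * u / lineQuadratic c1 c5 c7 u with hf
  have hfc : ContinuousOn f (Icc A B) :=
    ContinuousOn.div (by fun_prop) (continuous_lineQuadratic c1 c5 c7).continuousOn h0
  -- Extending by the endpoint values makes `G` differentiable on the whole line; its equation is
  -- claimed only on `[A, B]`.
  obtain ⟨F, hF⟩ := (continuous_IccExtend_iff.2 hfc.domRestrict :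
    Continuous (IccExtend hAB ((Icc A B).domRestrict f))).exists_hasDerivAt
  refine ⟨fun u => Real.exp (F u), fun u => Real.exp_pos _,
    fun u => (hF u).exp.differentiableAt, fun u hu => (hF u).exp.congr_deriv ?_⟩
  rw [IccExtend_of_mem _ _ hu]
  simp only [domRestrict_apply, hf]
  ring

/-- This is what dictates `G`: after subtracting `(c5 + c7) u u' ρ` from `L ρ' / 2`, only a `c2`
term with the factors `v²` and `ρ` remains. -/
lemma radial_identity (hc1 : c1 ≠ 0) (c2 c5 c7 : ℝ) (q : ℝ × ℝ) :
    2 * c1 * ((q.1 * (planarField c1 c2 c5 c7 q).1 + q.2 * (planarField c1 c2 c5 c7 q).2) *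
        lineQuadratic c1 c5 c7 q.1 -
      (1 + q.1 ^ 2 + q.2 ^ 2) * (c5 + c7) * q.1 * (planarField c1 c2 c5 c7 q).1) =
      -(2 * (c5 + c7) * c2 * c5 * q.2 ^ 2 * (1 + q.1 ^ 2 + q.2 ^ 2)) := by
  simp only [planarField, lineQuadratic]
  field_simp
  ring

lemma hasDerivAt_firstIntegral (hc1 : c1 ≠ 0) {G : ℝ → ℝ} {t : ℝ} (hG : 0 < G (γ t).1)
    (hGd : HasDerivAt G (2 * (c5 + c7) * (γ t).1 / lineQuadratic c1 c5 c7 (γ t).1 * G (γ t).1)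
      (γ t).1)
    (h0 : lineQuadratic c1 c5 c7 (γ t).1 ≠ 0)
    (hγ : HasDerivAt γ (planarField c1 c2 c5 c7 (γ t)) t) :
    HasDerivAt (fun t => (1 + (γ t).1 ^ 2 + (γ t).2 ^ 2) / G (γ t).1)
      (-(2 * (c5 + c7) * c2 * c5 * (γ t).2 ^ 2 / (c1 * lineQuadratic c1 c5 c7 (γ t).1))
        * ((1 + (γ t).1 ^ 2 + (γ t).2 ^ 2) / G (γ t).1)) t := by
  have hu := hγ.planar_fst
  have hv := hγ.planar_snd
  have hGu := hGd.comp t hu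
  have h1 := (((hu.pow 2).const_add 1).add (hv.pow 2)).div hGu hG.ne'
  refine h1.congr_deriv ?_
  have hG' := hG.ne'
  have key := radial_identity hc1 c2 c5 c7 (γ t)
  simp only [Function.comp, Pi.add_apply, Pi.pow_apply]
  generalize G (γ t).1 = g at *
  generalize planarField c1 c2 c5 c7 (γ t) = X at *
  generalize γ t = q at *
  obtain ⟨u, v⟩ := q
  simp only at *
  generalize lineQuadratic c1 c5 c7 u = D at *
  norm_num
  field_simp
  linear_combination key / 2

lemma exists_range_fst_eq_Icc (hT : 0 < T) (hγc : Continuous γ) (hp : Function.Periodic γ T) :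
    ∃ a b : ℝ, a ≤ b ∧ range (fun t => (γ t).1) = Icc a b := by
  have hc : Continuous fun t => (γ t).1 := by fun_prop
  have hcomp : IsCompact (range fun t => (γ t).1) :=
    Function.Periodic.compact_of_continuous (c := T) (fun t => by simp only [hp t]) hT.ne' hc
  have h := eq_Icc_of_connected_compact (isConnected_range hc) hcomp
  refine ⟨_, _, ?_, h⟩
  have hm : (γ 0).1 ∈ range fun t => (γ t).1 := mem_range_self 0
  rw [h] at hm
  exact hm.1.trans hm.2

/-- For `c₂ ≠ 0` the planar system has no periodic orbit. -/
theorem not_isPeriodicOrbit_planarField (hc1 : c1 ≠ 0) (hc57 : 0 < c5 * c7) (hc2 : c2 ≠ 0)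
    (Γ : Set (ℝ × ℝ)) : ¬ IsPeriodicOrbit (planarField c1 c2 c5 c7) Γ := by
  rintro ⟨γ, T, hT, hγ, hp, hne, -⟩
  have hγc : Continuous γ := continuous_iff_continuousAt.2 fun t => (hγ t).continuousAt
  obtain ⟨a, b, hab, hr⟩ := exists_range_fst_eq_Icc hT hγc hp
  have hmem : ∀ t, (γ t).1 ∈ Icc a b := fun t => hr ▸ mem_range_self (f := fun t => (γ t).1) t
  have h0 : ∀ u ∈ Icc a b, lineQuadratic c1 c5 c7 u ≠ 0 := by
    intro u hu
    rw [← hr] at hu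
    obtain ⟨t, rfl⟩ := hu
    exact lineQuadratic_ne_zero_of_periodic hc1 hT hγ hp hne t
  obtain ⟨ε, hε, hεq⟩ := exists_sign_of_ne_zero isPreconnected_Icc
    (continuous_lineQuadratic c1 c5 c7).continuousOn h0
  obtain ⟨G, hG, -, hGd⟩ := exists_integratingFactor hab h0
  have hs : c5 * (c5 + c7) ≠ 0 := by nlinarith [mul_self_nonneg c5]
  have hs' : c5 + c7 ≠ 0 := right_ne_zero_of_mul hs
  have hc5 : c5 ≠ 0 := left_ne_zero_of_mul hs
  have hε0 : ε ≠ 0 := by rintro rfl; norm_num at hε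
  obtain ⟨t, ht⟩ := exists_snd_ne_zero hc1 hγ hne
  -- The multiplier turns the coefficient into a square times `ε L > 0`.
  have hz := deriv_eq_zero_of_periodic (σ := -((c5 + c7) * c2 * c5 * c1 * ε)) hT
    (fun t => by simp only [hp t])
    (fun t => hasDerivAt_firstIntegral hc1 (hG _) (hGd _ (hmem t)) (h0 _ (hmem t)) (hγ t))
    (by simp [hs', hc2, hc5, hc1, hε0]) (fun t => ?_) t
  · have hq := h0 _ (hmem t)
    have hG' := (hG (γ t).1).ne'
    have hρ : 1 + (γ t).1 ^ 2 + (γ t).2 ^ 2 ≠ 0 := by positivity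
    simp [hs', hc2, hc5, hc1, hq, hG', hρ, ht] at hz
  · have hq := h0 _ (hmem t)
    have hG' := hG (γ t).1
    have : -((c5 + c7) * c2 * c5 * c1 * ε) *
        (-(2 * (c5 + c7) * c2 * c5 * (γ t).2 ^ 2 / (c1 * lineQuadratic c1 c5 c7 (γ t).1))
        * ((1 + (γ t).1 ^ 2 + (γ t).2 ^ 2) / G (γ t).1)) =
        2 * ((c5 + c7) * c2 * c5 * (γ t).2) ^ 2 * (ε * lineQuadratic c1 c5 c7 (γ t).1) /
          lineQuadratic c1 c5 c7 (γ t).1 ^ 2 *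
          ((1 + (γ t).1 ^ 2 + (γ t).2 ^ 2) / G (γ t).1) := by
      field_simp
    rw [this]
    have := (hεq _ (hmem t)).le
    positivity

end Solutions

/-! ### Level ovals as the periodic orbits for `c2 = 0`. -/

lemma HasDerivAt.nonneg_of_zero_of_nonneg_right {f : ℝ → ℝ} {f' a b : ℝ} (hf : HasDerivAt f f' a)
    (hab : a < b) (h0 : f a = 0) (h : ∀ x ∈ Ioo a b, 0 ≤ f x) : 0 ≤ f' := by
  have ht := (hasDerivAt_iff_tendsto_slope.1 hf).mono_left (nhdsGT_le_nhdsNE a)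
  refine ge_of_tendsto ht ?_
  filter_upwards [Ioo_mem_nhdsGT hab] with x hx
  rw [slope_def_field, h0, sub_zero]
  exact div_nonneg (h x hx) (sub_pos.2 hx.1).le

lemma HasDerivAt.nonpos_of_zero_of_nonneg_left {f : ℝ → ℝ} {f' a b : ℝ} (hf : HasDerivAt f f' b)
    (hab : a < b) (h0 : f b = 0) (h : ∀ x ∈ Ioo a b, 0 ≤ f x) : f' ≤ 0 := by
  have ht := (hasDerivAt_iff_tendsto_slope.1 hf).mono_left (nhdsLT_le_nhdsNE b)
  refine le_of_tendsto ht ?_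
  filter_upwards [Ioo_mem_nhdsLT hab] with x hx
  rw [slope_def_field, h0, sub_zero]
  exact div_nonpos_of_nonneg_of_nonpos (h x hx) (sub_neg.2 hx.2).le

/-- On a level set of the first integral, `v²` as a function of `u`. -/
def levelFun (G : ℝ → ℝ) (k u : ℝ) : ℝ := k * G u - 1 - u ^ 2

/-- The part of a level set of the first integral over `[a, b]`. -/
def levelOval (G : ℝ → ℝ) (k a b : ℝ) : Set (ℝ × ℝ) :=
  {q | q.1 ∈ Icc a b ∧ q.2 ^ 2 = levelFun G k q.1}

lemma differentiable_levelFun {G : ℝ → ℝ} (hG : Differentiable ℝ G) (k : ℝ) :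
    Differentiable ℝ (levelFun G k) := by
  unfold levelFun
  fun_prop

section Level

variable {c1 c5 c7 : ℝ} {G : ℝ → ℝ} {u : ℝ}

lemma hasDerivAt_levelFun (k : ℝ)
    (hGd : HasDerivAt G (2 * (c5 + c7) * u / lineQuadratic c1 c5 c7 u * G u) u) :
    HasDerivAt (levelFun G k)
      (k * (2 * (c5 + c7) * u / lineQuadratic c1 c5 c7 u * G u) - 2 * u) u := by
  have := ((hGd.const_mul k).sub_const 1).sub (hasDerivAt_pow 2 u)
  exact this.congr_deriv (by norm_num)

/-- On a level set `v² = N(u)` the field is `L(u)` times the tangent field `(-v, -N'(u) / 2)`, the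
form required by `exists_periodic_solution`. -/
lemma planarField_zero_eq {k : ℝ} (h0 : lineQuadratic c1 c5 c7 u ≠ 0)
    (hGd : HasDerivAt G (2 * (c5 + c7) * u / lineQuadratic c1 c5 c7 u * G u) u) {v : ℝ}
    (hv : v ^ 2 = levelFun G k u) :
    planarField c1 0 c5 c7 (u, v) =
      (-v * lineQuadratic c1 c5 c7 u,
        -deriv (levelFun G k) u * lineQuadratic c1 c5 c7 u / 2) := by
  rw [(hasDerivAt_levelFun k hGd).deriv]
  have hk : k * G u = 1 + u ^ 2 + v ^ 2 := by rw [hv, levelFun]; ring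
  refine Prod.ext ?_ ?_
  · simp only [planarField, lineQuadratic]
    ring
  · have : -(k * (2 * (c5 + c7) * u / lineQuadratic c1 c5 c7 u * G u) - 2 * u) *
        lineQuadratic c1 c5 c7 u / 2 =
        -(c5 + c7) * u * (k * G u) + u * lineQuadratic c1 c5 c7 u := by
      field_simp
      ring
    rw [this, hk]
    simp only [planarField, lineQuadratic]
    ring

/-- A component of a level set bounded by two regular points of the `u`-axis is a periodic
orbit. -/
lemma isPeriodicOrbit_levelOval (hc1 : c1 ≠ 0) (hc57 : 0 < c5 * c7) {k a b : ℝ} (hab : a < b)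
    (h0 : ∀ u ∈ Icc a b, lineQuadratic c1 c5 c7 u ≠ 0) (hG : Differentiable ℝ G)
    (hGd : ∀ u ∈ Icc a b, HasDerivAt G (2 * (c5 + c7) * u / lineQuadratic c1 c5 c7 u * G u) u)
    (ha : levelFun G k a = 0) (hb : levelFun G k b = 0) (hpos : ∀ u ∈ Ioo a b, 0 < levelFun G k u)
    (ha' : a * (c7 + c1 * a) ≠ 0) (hb' : b * (c7 + c1 * b) ≠ 0) :
    IsPeriodicOrbit (planarField c1 0 c5 c7) (levelOval G k a b) := by
  have hN := differentiable_levelFun hG k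
  -- A double zero of `N` on the axis would be a singular point of the field.
  have hne : ∀ u ∈ Icc a b, levelFun G k u = 0 → u * (c7 + c1 * u) ≠ 0 →
      deriv (levelFun G k) u ≠ 0 := by
    intro u hu hz hr hd
    have := planarField_zero_eq (v := 0) (h0 u hu) (hGd u hu) (by rw [hz]; norm_num)
    rw [hd] at this
    exact hr ((planarField_eq_zero_iff hc1 hc57 0 _).1 (this.trans (by simp))).2
  have hma : a ∈ Icc a b := left_mem_Icc.2 hab.le
  have hmb : b ∈ Icc a b := right_mem_Icc.2 hab.le
  obtain ⟨γ, T, hT, hp, hγ, hr⟩ := exists_periodic_solution hN (continuous_lineQuadratic c1 c5 c7)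
    hab ha hb hpos
    (((hN a).hasDerivAt.nonneg_of_zero_of_nonneg_right hab ha fun x hx => (hpos x hx).le).lt_of_ne
      (hne a hma ha ha').symm)
    (((hN b).hasDerivAt.nonpos_of_zero_of_nonneg_left hab hb fun x hx => (hpos x hx).le).lt_of_ne
      (hne b hmb hb hb')) h0
  have hmem : ∀ t, (γ t).1 ∈ Icc a b ∧ (γ t).2 ^ 2 = levelFun G k (γ t).1 := fun t => by
    have : γ t ∈ range γ := mem_range_self t
    rw [hr] at this
    exact this
  refine ⟨γ, T, hT, fun t => ?_, hp, ?_, hr.symm⟩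
  · have := planarField_zero_eq (h0 _ (hmem t).1) (hGd _ (hmem t).1) (hmem t).2
    rw [Prod.mk.eta] at this
    rw [this]
    exact hγ t
  · by_contra hc
    push Not at hc
    have h1 : (a, (0 : ℝ)) ∈ range γ := by rw [hr]; exact ⟨hma, by simp [ha]⟩
    have h2 : (b, (0 : ℝ)) ∈ range γ := by rw [hr]; exact ⟨hmb, by simp [hb]⟩
    obtain ⟨s, hs⟩ := h1
    obtain ⟨t, ht⟩ := h2
    have := congrArg Prod.fst (hs.symm.trans ((hc s).trans ((hc t).symm.trans ht)))
    exact hab.ne this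

/-- Every periodic orbit of the planar system with `c₂ = 0` is a component of a level set of the
first integral. -/
lemma exists_eq_levelOval_of_isPeriodicOrbit (hc1 : c1 ≠ 0) (hc57 : 0 < c5 * c7)
    {Γ : Set (ℝ × ℝ)} (hΓ : IsPeriodicOrbit (planarField c1 0 c5 c7) Γ) :
    ∃ (a b k : ℝ) (G : ℝ → ℝ), a < b ∧ (∀ u ∈ Icc a b, lineQuadratic c1 c5 c7 u ≠ 0) ∧
      (∀ u, 0 < G u) ∧ Differentiable ℝ G ∧
      (∀ u ∈ Icc a b, HasDerivAt G (2 * (c5 + c7) * u / lineQuadratic c1 c5 c7 u * G u) u) ∧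
      levelFun G k a = 0 ∧ levelFun G k b = 0 ∧ (∀ u ∈ Ioo a b, 0 < levelFun G k u) ∧
      Γ = levelOval G k a b := by
  obtain ⟨γ, T, hT, hγ, hp, hne, rfl⟩ := hΓ
  have hγc : Continuous γ := continuous_iff_continuousAt.2 fun t => (hγ t).continuousAt
  obtain ⟨a, b, hab, hr⟩ := exists_range_fst_eq_Icc hT hγc hp
  have hmem : ∀ t, (γ t).1 ∈ Icc a b := fun t => hr ▸ mem_range_self (f := fun t => (γ t).1) t
  have hex : ∀ u ∈ Icc a b, ∃ t, (γ t).1 = u := fun u hu => by rw [← hr] at hu; exact hu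
  have h0 : ∀ u ∈ Icc a b, lineQuadratic c1 c5 c7 u ≠ 0 := by
    intro u hu
    obtain ⟨t, rfl⟩ := hex u hu
    exact lineQuadratic_ne_zero_of_periodic hc1 hT hγ hp hne t
  obtain ⟨G, hG, hGdiff, hGd⟩ := exists_integratingFactor hab h0
  have hL : ∀ t, HasDerivAt (fun t => (1 + (γ t).1 ^ 2 + (γ t).2 ^ 2) / G (γ t).1) 0 t := fun t =>
    (hasDerivAt_firstIntegral hc1 (hG _) (hGd _ (hmem t)) (h0 _ (hmem t)) (hγ t)).congr_deriv
      (by ring)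
  obtain ⟨k, hk⟩ : ∃ k, ∀ t, (γ t).2 ^ 2 = levelFun G k (γ t).1 := by
    refine ⟨(1 + (γ 0).1 ^ 2 + (γ 0).2 ^ 2) / G (γ 0).1, fun t => ?_⟩
    have := is_const_of_deriv_eq_zero (fun t => (hL t).differentiableAt) (fun t => (hL t).deriv) 0 t
    rw [levelFun, this, div_mul_cancel₀ _ (hG _).ne']
    ring
  have hN0 : ∀ u ∈ Icc a b, 0 ≤ levelFun G k u := by
    intro u hu
    obtain ⟨t, rfl⟩ := hex u hu
    rw [← hk]
    positivity
  have hns : ∀ t, (γ t).2 = 0 → (γ t).1 * (c7 + c1 * (γ t).1) ≠ 0 := fun t ht h =>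
    planarField_ne_zero_of_periodic hT hγ hp hne t
      ((planarField_eq_zero_iff hc1 hc57 0 _).2 ⟨ht, h⟩)
  have hzero : ∀ t, (planarField c1 0 c5 c7 (γ t)).1 = 0 → (γ t).2 = 0 := fun t ht => by
    rw [planarField_fst hc1] at ht
    simpa [h0 _ (hmem t)] using ht
  have hab' : a < b := by
    refine lt_of_le_of_ne hab fun h => ?_
    obtain ⟨t, ht⟩ := exists_snd_ne_zero hc1 hγ hne
    refine ht (hzero t ?_)
    have h1 := (hγ t).planar_fst
    have h2 : (fun t => (γ t).1) = fun _ => a :=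
      funext fun t => le_antisymm (h ▸ (hmem t).2) (hmem t).1
    rw [h2] at h1
    exact h1.unique (hasDerivAt_const t a)
  obtain ⟨ta, hta⟩ := hex a (left_mem_Icc.2 hab)
  obtain ⟨tb, htb⟩ := hex b (right_mem_Icc.2 hab)
  -- At the extreme values of `u` on the orbit, `u' = 0`, which forces `v = 0` because `L ≠ 0`.
  have hva : (γ ta).2 = 0 := hzero ta (IsLocalMin.hasDerivAt_eq_zero
    (Filter.Eventually.of_forall fun t => by simpa only [hta] using (hmem t).1) (hγ ta).planar_fst)
  have hvb : (γ tb).2 = 0 := hzero tb (IsLocalMax.hasDerivAt_eq_zero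
    (Filter.Eventually.of_forall fun t => by simpa only [htb] using (hmem t).2) (hγ tb).planar_fst)
  have hNa : levelFun G k a = 0 := by rw [← hta, ← hk, hva]; norm_num
  have hNb : levelFun G k b = 0 := by rw [← htb, ← hk, hvb]; norm_num
  have hNpos : ∀ u ∈ Ioo a b, 0 < levelFun G k u := by
    intro u hu
    have hu' := Ioo_subset_Icc_self hu
    -- An interior zero would be a minimum of `N ≥ 0`, making the orbit pass through a singular
    -- point.
    refine (hN0 u hu').lt_of_ne fun hz => ?_
    obtain ⟨t, rfl⟩ := hex u hu'
    have hv : (γ t).2 = 0 := by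
      have := hk t
      rw [← hz] at this
      exact pow_eq_zero_iff two_ne_zero |>.1 this
    have hmin : IsLocalMin (levelFun G k) (γ t).1 := by
      filter_upwards [Ioo_mem_nhds hu.1 hu.2] with x hx
      rw [← hz]
      exact hN0 x (Ioo_subset_Icc_self hx)
    have h1 := planarField_zero_eq (h0 _ hu') (hGd _ hu') (hk t)
    rw [Prod.mk.eta, hmin.deriv_eq_zero, hv] at h1
    exact planarField_ne_zero_of_periodic hT hγ hp hne t (by rw [h1]; simp)
  refine ⟨a, b, k, G, hab', h0, hG, hGdiff, hGd, hNa, hNb, hNpos, ?_⟩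
  -- So far the orbit is only contained in the oval. The oval is itself a periodic orbit through `γ
  -- ta`, and uniqueness gives equality.
  obtain ⟨δ, S, hS, hδ, hδp, -, hδr⟩ := isPeriodicOrbit_levelOval hc1 hc57 hab' h0 hGdiff hGd hNa
    hNb hNpos (hta ▸ hns ta hva) (htb ▸ hns tb hvb)
  obtain ⟨s, hs⟩ : γ ta ∈ range δ := by
    rw [← hδr]
    exact ⟨hmem ta, hk ta⟩
  have heq := eq_of_periodic_solutions (contDiff_planarField c1 0 c5 c7) hT hS hp hδp hγ hδ hs.symm
  rw [hδr]
  ext q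
  constructor
  · rintro ⟨t, rfl⟩
    exact ⟨s + (t - ta), by rw [← heq, add_sub_cancel]⟩
  · rintro ⟨t, rfl⟩
    exact ⟨ta + (t - s), by rw [heq, add_sub_cancel]⟩

/-! ### Nearby ovals: no periodic orbit is isolated for `c2 = 0`. -/

/-- A positive continuous function vanishing or negative at both ends of an interval has a
positivity interval between consecutive zeros around an interior point. -/
lemma exists_zeros_around {f : ℝ → ℝ} (hf : Continuous f) {a m b : ℝ} (ham : a ≤ m) (hmb : m ≤ b)
    (ha : f a ≤ 0) (hm : 0 < f m) (hb : f b ≤ 0) :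
    ∃ a' b', a ≤ a' ∧ a' < m ∧ m < b' ∧ b' ≤ b ∧ f a' = 0 ∧ f b' = 0 ∧
      ∀ x ∈ Ioo a' b', 0 < f x := by
  have hcl : IsClosed {x | f x ≤ 0} := isClosed_le hf continuous_const
  obtain ⟨a', ⟨ha'1, ha'2⟩, ha'm⟩ := (isCompact_Icc.inter_left hcl).exists_isGreatest
    (⟨a, ha, left_mem_Icc.2 ham⟩ : ({x | f x ≤ 0} ∩ Icc a m).Nonempty)
  obtain ⟨b', ⟨hb'1, hb'2⟩, hb'm⟩ := (isCompact_Icc.inter_left hcl).exists_isLeast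
    (⟨b, hb, right_mem_Icc.2 hmb⟩ : ({x | f x ≤ 0} ∩ Icc m b).Nonempty)
  have h1 : a' < m := ha'2.2.lt_of_ne fun h => (not_lt.2 ha'1) (h ▸ hm)
  have h2 : m < b' := hb'2.1.lt_of_ne fun h => (not_lt.2 hb'1) (h ▸ hm)
  have hpos : ∀ x ∈ Ioo a' b', 0 < f x := by
    intro x hx
    by_contra hn
    push Not at hn
    rcases le_total x m with h | h
    · exact (not_lt.2 (ha'm ⟨hn, ha'2.1.trans hx.1.le, h⟩)) hx.1
    · exact (not_lt.2 (hb'm ⟨hn, h, hx.2.le.trans hb'2.2⟩)) hx.2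
  have hcl' : closure (Ioo a' b') ⊆ {x | 0 ≤ f x} :=
    closure_minimal (fun x hx => (hpos x hx).le) (isClosed_le continuous_const hf)
  rw [closure_Ioo (h1.trans h2).ne] at hcl'
  exact ⟨a', b', ha'2.1, h1, h2, hb'2.2,
    le_antisymm ha'1 (hcl' (left_mem_Icc.2 (h1.trans h2).le)),
    le_antisymm hb'1 (hcl' (right_mem_Icc.2 (h1.trans h2).le)), hpos⟩

/-- For `c₂ = 0` no periodic orbit is isolated. -/
theorem not_isLimitCycle_planarField_zero (hc1 : c1 ≠ 0) (hc57 : 0 < c5 * c7) (Γ : Set (ℝ × ℝ)) :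
    ¬ IsLimitCycle (planarField c1 0 c5 c7) Γ := by
  rintro ⟨hΓ, U, hU, hΓU, hiso⟩
  obtain ⟨a, b, k, G, hab, h0, hG, hGdiff, hGd, hNa, hNb, hNpos, rfl⟩ :=
    exists_eq_levelOval_of_isPeriodicOrbit hc1 hc57 hΓ
  have hGc := hGdiff.continuous
  have hNc : ∀ k, Continuous (levelFun G k) := fun k => (differentiable_levelFun hGdiff k).continuous
  set m := (a + b) / 2 with hm
  have ham : a < m := by rw [hm]; linarith
  have hmb : m < b := by rw [hm]; linarith
  obtain ⟨R, hR⟩ := isCompact_Icc.bddAbove_image ((hNc k).continuousOn (s := Icc a b))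
  obtain ⟨C, hC⟩ := isCompact_Icc.bddAbove_image (hGc.continuousOn (s := Icc a b))
  have hR' : ∀ u ∈ Icc a b, levelFun G k u ≤ R := fun u hu => hR (mem_image_of_mem _ hu)
  have hC' : ∀ u ∈ Icc a b, G u ≤ C := fun u hu => hC (mem_image_of_mem _ hu)
  have hC0 : 0 < C := (hG a).trans_le (hC' a (left_mem_Icc.2 hab.le))
  -- Compactness: outside `U`, in the relevant box, `|v² - N(u)|` is bounded away from zero.
  obtain ⟨δ, hδ, hδU⟩ : ∃ δ > 0, ∀ q : ℝ × ℝ, q.1 ∈ Icc a b → q.2 ^ 2 ≤ R →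
      |q.2 ^ 2 - levelFun G k q.1| < δ → q ∈ U := by
    set K : Set (ℝ × ℝ) := (Icc a b ×ˢ Icc (-(R + 1)) (R + 1)) ∩ Uᶜ with hK
    have hKc : IsCompact K := (isCompact_Icc.prod isCompact_Icc).inter_right hU.isClosed_compl
    have hKf : ContinuousOn (fun q : ℝ × ℝ => |q.2 ^ 2 - levelFun G k q.1|) K :=
      (((continuous_snd.pow 2).sub ((hNc k).comp continuous_fst)).abs).continuousOn
    have hqK : ∀ q : ℝ × ℝ, q.1 ∈ Icc a b → q.2 ^ 2 ≤ R → q ∉ U → q ∈ K := by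
      intro q h1 h2 h3
      refine ⟨⟨h1, ?_, ?_⟩, h3⟩ <;> nlinarith [sq_nonneg (q.2 - 1), sq_nonneg (q.2 + 1)]
    rcases K.eq_empty_or_nonempty with hemp | hnon
    · refine ⟨1, one_pos, fun q h1 h2 _ => ?_⟩
      by_contra h3
      have := hqK q h1 h2 h3
      rw [hemp] at this
      exact this
    · obtain ⟨q₀, hq₀, hmin⟩ := hKc.exists_isMinOn hnon hKf
      refine ⟨|q₀.2 ^ 2 - levelFun G k q₀.1|, abs_pos.2 (fun h => ?_), fun q h1 h2 h3 => ?_⟩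
      · exact hq₀.2 (hΓU ⟨hq₀.1.1, sub_eq_zero.1 h⟩)
      · by_contra h4
        exact (not_lt.2 (hmin (hqK q h1 h2 h4))) h3
  have hmm : m ∈ Icc a b := ⟨ham.le, hmb.le⟩
  -- The first bound keeps the new oval inside `U`, the second keeps its level function positive at
  -- `m`.
  set η := min (δ / C) (levelFun G k m / G m) with hη
  have hη0 : 0 < η := lt_min (div_pos hδ hC0) (div_pos (hNpos m ⟨ham, hmb⟩) (hG m))
  -- The two excluded values are the levels through the singular points `(0, 0)` and `(-c7 / c1,
  -- 0)`.
  obtain ⟨k', ⟨hk1, hk2⟩, hk3⟩ := (Ioo_infinite (sub_lt_self k hη0)).exists_notMem_finset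
    {1 / G 0, (1 + (-c7 / c1) ^ 2) / G (-c7 / c1)}
  simp only [Finset.mem_insert, Finset.mem_singleton, not_or] at hk3
  have hshift : ∀ u, levelFun G k' u = levelFun G k u - (k - k') * G u := fun u => by
    simp only [levelFun]; ring
  have hkk : 0 < k - k' := by linarith
  have hkC : (k - k') * C < δ := by
    rw [← lt_div_iff₀ hC0]
    exact lt_of_lt_of_le (by linarith) (min_le_left _ _)
  have hkm : 0 < levelFun G k' m := by
    have : (k - k') * G m < levelFun G k m := by
      rw [← lt_div_iff₀ (hG m)]
      exact lt_of_lt_of_le (by linarith) (min_le_right _ _)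
    rw [hshift]
    linarith
  obtain ⟨a', b', haa, ham', hmb', hbb, hza, hzb, hpos⟩ := exists_zeros_around (hNc k') ham.le hmb.le
    (by rw [hshift, hNa]; nlinarith [mul_pos hkk (hG a)]) hkm
    (by rw [hshift, hNb]; nlinarith [mul_pos hkk (hG b)])
  have hsub : Icc a' b' ⊆ Icc a b := Icc_subset_Icc haa hbb
  have hreg : ∀ u, levelFun G k' u = 0 → u * (c7 + c1 * u) ≠ 0 := by
    intro u hu h
    have hku : k' = (1 + u ^ 2) / G u := by
      rw [eq_div_iff (hG u).ne']
      simp only [levelFun] at hu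
      linarith
    rcases mul_eq_zero.1 h with rfl | h
    · exact hk3.1 (by rw [hku]; norm_num)
    · have : u = -c7 / c1 := by
        rw [eq_div_iff hc1]
        linarith
      exact hk3.2 (by rw [hku, this])
  have hper := isPeriodicOrbit_levelOval hc1 hc57 (ham'.trans hmb') (fun u hu => h0 u (hsub hu))
    hGdiff (fun u hu => hGd u (hsub hu)) hza hzb hpos (hreg a' hza) (hreg b' hzb)
  have heq := hiso _ hper (fun q hq => by
    have hq1 := hsub hq.1
    have hGq := mul_le_mul_of_nonneg_left (hC' _ hq1) hkk.le
    have hGq0 := mul_pos hkk (hG q.1)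
    have h2 := hq.2
    rw [hshift] at h2
    refine hδU q hq1 ?_ ?_
    · linarith [hR' _ hq1]
    · rw [h2, abs_lt]
      constructor <;> linarith)
  -- Equal ovals would put this point on two distinct levels.
  have hmem : (a', (0 : ℝ)) ∈ levelOval G k' a' b' :=
    ⟨left_mem_Icc.2 (ham'.trans hmb').le, by simp [hza]⟩
  have hmem' := hmem
  rw [heq] at hmem'
  have h1 : (0 : ℝ) ^ 2 = levelFun G k a' := hmem'.2
  rw [hshift] at hza
  nlinarith [mul_pos hkk (hG a')]

/-! ### Interior of an oval, and the center for `c2 = 0`. -/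

/-- The region enclosed by a level oval is bounded by it. -/
lemma surrounds_levelOval {k a b : ℝ} (hG : Continuous G)
    (ha : levelFun G k a = 0) (hb : levelFun G k b = 0) {q : ℝ × ℝ} (hq : q.1 ∈ Ioo a b)
    (hqk : q.2 ^ 2 < levelFun G k q.1) : Surrounds (levelOval G k a b) q := by
  have hN : Continuous (levelFun G k) := by
    unfold levelFun
    fun_prop
  have hqΓ : q ∉ levelOval G k a b := fun h => hqk.ne h.2
  refine ⟨hqΓ, ?_⟩
  set D : Set (ℝ × ℝ) := {q | q.1 ∈ Ioo a b ∧ q.2 ^ 2 < levelFun G k q.1} with hD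
  set E : Set (ℝ × ℝ) := {q | q.1 ∈ Icc a b ∧ q.2 ^ 2 ≤ levelFun G k q.1} with hE
  have hDo : IsOpen D := (isOpen_Ioo.preimage continuous_fst).inter
    (isOpen_lt (continuous_snd.pow 2) (hN.comp continuous_fst))
  have hEc : IsClosed E := (isClosed_Icc.preimage continuous_fst).inter
    (isClosed_le (continuous_snd.pow 2) (hN.comp continuous_fst))
  obtain ⟨R, hR⟩ := isCompact_Icc.bddAbove_image (hN.continuousOn (s := Icc a b))
  have hEb : Bornology.IsBounded E := by
    refine ((isCompact_Icc (a := a) (b := b)).prod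
      (isCompact_Icc (a := -(R + 1)) (b := R + 1))).isBounded.subset fun x hx => ?_
    have := hx.2.trans (hR (mem_image_of_mem _ hx.1))
    refine ⟨hx.1, ?_, ?_⟩ <;> nlinarith [sq_nonneg (x.2 - 1), sq_nonneg (x.2 + 1)]
  have hDE : D ⊆ E := fun x hx => ⟨Ioo_subset_Icc_self hx.1, hx.2.le⟩
  refine hEb.subset (Subset.trans ?_ hDE)
  -- The open sets `D` and `Eᶜ` are disjoint and cover the complement of the oval, so the component
  -- of `q` stays in the bounded set `D`.
  refine IsPreconnected.subset_left_of_subset_union hDo hEc.isOpen_compl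
    (disjoint_compl_right_iff_subset.2 hDE) (fun x hx => ?_)
    ⟨q, mem_connectedComponentIn hqΓ, hq, hqk⟩ isPreconnected_connectedComponentIn
  have hxΓ : x ∉ levelOval G k a b := connectedComponentIn_subset _ _ hx
  by_cases hxE : x ∈ E
  · left
    obtain ⟨hx1, hx2⟩ := hxE
    have hlt : x.2 ^ 2 < levelFun G k x.1 := hx2.lt_of_ne fun h => hxΓ ⟨hx1, h⟩
    refine ⟨⟨hx1.1.lt_of_ne fun h => ?_, hx1.2.lt_of_ne fun h => ?_⟩, hlt⟩
    · rw [← h, ha] at hlt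
      exact (not_lt.2 (sq_nonneg _)) hlt
    · rw [h, hb] at hlt
      exact (not_lt.2 (sq_nonneg _)) hlt
  · exact Or.inr hxE

end Level

/-- The function is the value of the first integral at `(u, 0)`. The derivative is grouped so that,
near `-c7 / c1`, its sign is that of `u - -c7 / c1`. -/
lemma hasDerivAt_levelValue {c1 c5 c7 : ℝ} (hc1 : c1 ≠ 0) {G : ℝ → ℝ} {u : ℝ} (hG : 0 < G u)
    (h0 : lineQuadratic c1 c5 c7 u ≠ 0)
    (hGd : HasDerivAt G (2 * (c5 + c7) * u / lineQuadratic c1 c5 c7 u * G u) u) :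
    HasDerivAt (fun u => (1 + u ^ 2) / G u)
      (2 * (-(u * c1) * lineQuadratic c1 c5 c7 u) * (u - -c7 / c1) /
        (lineQuadratic c1 c5 c7 u ^ 2 * G u)) u := by
  have h := ((hasDerivAt_pow 2 u).const_add 1).div hGd hG.ne'
  refine h.congr_deriv ?_
  have hG' := hG.ne'
  have hq : lineQuadratic c1 c5 c7 u = (c5 + c7) * u ^ 2 - c1 * u + c5 := rfl
  generalize lineQuadratic c1 c5 c7 u = D at *
  generalize G u = g at *
  norm_num
  field_simp
  linear_combination u * hq

/-- For `c₂ = 0` the singular point `(-c₇ / c₁, 0)` is a center. -/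
theorem isCenter_planarField_zero {c1 c5 c7 : ℝ} (hc1 : c1 ≠ 0) (hc57 : 0 < c5 * c7) :
    IsCenter (planarField c1 0 c5 c7) (-c7 / c1, 0) := by
  refine ⟨(planarField_eq_zero_iff hc1 hc57 0 _).2 ⟨rfl, ?_⟩, ?_⟩
  · field_simp
    ring
  set m := -c7 / c1 with hm
  have hc1m : c1 * m = -c7 := mul_div_cancel₀ _ hc1
  -- Positivity of this one product near `m` excludes both `u = 0` and the zeros of `L`, and fixes
  -- the monotonicity of `M` on each side of `m`.
  have hpos_m : 0 < -(m * c1) * lineQuadratic c1 c5 c7 m := by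
    have : -(m * c1) * lineQuadratic c1 c5 c7 m = (c5 * c7 + c7 ^ 2) * (m ^ 2 + 1) := by
      simp only [lineQuadratic]
      linear_combination (-(c5 + c7) * m ^ 2 + c1 * m - c5 - c7) * hc1m
    rw [this]
    positivity
  obtain ⟨η, hη, hηp⟩ : ∃ η > 0, ∀ u ∈ Icc (m - η) (m + η),
      0 < -(u * c1) * lineQuadratic c1 c5 c7 u := by
    have hc : Continuous fun u => -(u * c1) * lineQuadratic c1 c5 c7 u := by fun_prop
    obtain ⟨η, hη, h⟩ := Metric.nhds_basis_closedBall.mem_iff.1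
      (hc.continuousAt.eventually (lt_mem_nhds hpos_m))
    rw [Real.closedBall_eq_Icc] at h
    exact ⟨η, hη, fun u hu => h hu⟩
  set A := m - η with hA
  set B := m + η with hB
  have hAm : A < m := by linarith
  have hmB : m < B := by linarith
  have h0 : ∀ u ∈ Icc A B, lineQuadratic c1 c5 c7 u ≠ 0 := fun u hu =>
    right_ne_zero_of_mul (hηp u hu).ne'
  obtain ⟨G, hG, hGdiff, hGd⟩ := exists_integratingFactor (hAm.trans hmB).le h0
  have hGc := hGdiff.continuous
  have hNc : ∀ k, Continuous (levelFun G k) := fun k => (differentiable_levelFun hGdiff k).continuous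
  set M : ℝ → ℝ := fun u => (1 + u ^ 2) / G u with hM
  have hMc : Continuous M := Continuous.div (by fun_prop) hGc fun u => (hG u).ne'
  have hMG : ∀ u, M u * G u = 1 + u ^ 2 := fun u => div_mul_cancel₀ _ (hG u).ne'
  have hMd : ∀ u ∈ Icc A B, HasDerivAt M _ u := fun u hu =>
    hasDerivAt_levelValue hc1 (hG u) (h0 u hu) (hGd u hu)
  have hMono : StrictMonoOn M (Icc m B) := by
    refine strictMonoOn_of_deriv_pos (convex_Icc _ _) hMc.continuousOn fun u hu => ?_
    rw [interior_Icc] at hu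
    have hu' : u ∈ Icc A B := ⟨hAm.le.trans hu.1.le, hu.2.le⟩
    rw [(hMd u hu').deriv]
    have h2 := h0 u hu'
    exact div_pos (mul_pos (mul_pos two_pos (hηp u hu')) (sub_pos.2 hu.1))
      (mul_pos (by positivity) (hG u))
  have hAnti : StrictAntiOn M (Icc A m) := by
    refine strictAntiOn_of_deriv_neg (convex_Icc _ _) hMc.continuousOn fun u hu => ?_
    rw [interior_Icc] at hu
    have hu' : u ∈ Icc A B := ⟨hu.1.le, hu.2.le.trans hmB.le⟩
    rw [(hMd u hu').deriv]
    have h2 := h0 u hu'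
    exact div_neg_of_neg_of_pos
      (mul_neg_of_pos_of_neg (mul_pos two_pos (hηp u hu')) (sub_neg.2 hu.2))
      (mul_pos (by positivity) (hG u))
  have hMA : M m < M A := hAnti (left_mem_Icc.2 hAm.le) (right_mem_Icc.2 hAm.le) hAm
  have hMB : M m < M B := hMono (left_mem_Icc.2 hmB.le) (right_mem_Icc.2 hmB.le) hmB
  -- Levels below both end values close up strictly inside `(A, B)`.
  set k₀ := min (M A) (M B) with hk₀
  refine ⟨{q | q.1 ∈ Ioo A B ∧ q.2 ^ 2 < levelFun G k₀ q.1},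
    (isOpen_Ioo.preimage continuous_fst).inter
      (isOpen_lt (f := fun q : ℝ × ℝ => q.2 ^ 2) (g := fun q => levelFun G k₀ q.1)
        (continuous_snd.pow 2) ((hNc k₀).comp continuous_fst)), ⟨⟨hAm, hmB⟩, ?_⟩, ?_⟩
  · have := mul_lt_mul_of_pos_right (lt_min hMA hMB) (hG m)
    rw [hMG] at this
    simp only [levelFun]
    linarith
  rintro ⟨x, y⟩ ⟨⟨hx, hy⟩, hne⟩
  simp only at hx hy
  obtain ⟨k, hk⟩ : ∃ k, y ^ 2 = levelFun G k x :=
    ⟨(1 + x ^ 2 + y ^ 2) / G x, by rw [levelFun, div_mul_cancel₀ _ (hG x).ne']; ring⟩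
  have hsign : ∀ l u, levelFun G l u = (l - M u) * G u := fun l u => by
    rw [sub_mul, hMG, levelFun]; ring
  have hkk₀ : k < k₀ := by
    rw [hk, hsign, hsign] at hy
    linarith [lt_of_mul_lt_mul_right hy (hG x).le]
  have hMx : M x ≤ k := by
    have : 0 ≤ (k - M x) * G x := by rw [← hsign, ← hk]; positivity
    linarith [nonneg_of_mul_nonneg_left this (hG x)]
  have hMm : M m < k := by
    rcases lt_trichotomy x m with h | h | h
    · exact (hAnti ⟨hx.1.le, h.le⟩ (right_mem_Icc.2 hAm.le) h).trans_le hMx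
    · refine h ▸ hMx.lt_of_ne fun h' => hne ?_
      rw [hsign, h', sub_self, zero_mul] at hk
      exact Prod.ext h (pow_eq_zero_iff two_ne_zero |>.1 hk)
    · exact (hMono (left_mem_Icc.2 hmB.le) ⟨h.le, hx.2.le⟩ h).trans_le hMx
  have hkA : levelFun G k A < 0 := by
    rw [hsign]
    exact mul_neg_of_neg_of_pos (by linarith [min_le_left (M A) (M B)]) (hG A)
  have hkB : levelFun G k B < 0 := by
    rw [hsign]
    exact mul_neg_of_neg_of_pos (by linarith [min_le_right (M A) (M B)]) (hG B)
  have hkm : 0 < levelFun G k m := by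
    rw [hsign]
    exact mul_pos (sub_pos.2 hMm) (hG m)
  obtain ⟨a, b, hAa, ham, hmb, hbB, hza, hzb, hpos⟩ :=
    exists_zeros_around (hNc k) hAm.le hmB.le hkA.le hkm hkB.le
  have hAa' : A < a := hAa.lt_of_ne fun h => hkA.ne (h ▸ hza)
  have hbB' : b < B := hbB.lt_of_ne fun h => hkB.ne (h ▸ hzb)
  have hsub : Icc a b ⊆ Icc A B := Icc_subset_Icc hAa hbB
  have hreg : ∀ u ∈ Icc a b, u ≠ m → u * (c7 + c1 * u) ≠ 0 := by
    intro u hu hum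
    refine mul_ne_zero ?_ fun h => hum ?_
    · rintro rfl
      simpa using hηp 0 (hsub hu)
    · rw [hm, eq_div_iff hc1]
      linarith
  have hlevel : ∀ u, levelFun G k u = 0 → M u = k := fun u hu => by
    rw [hsign] at hu
    linarith [(mul_eq_zero.1 hu).resolve_right (hG u).ne']
  refine ⟨levelOval G k a b, isPeriodicOrbit_levelOval hc1 hc57 (ham.trans hmb)
    (fun u hu => h0 u (hsub hu)) hGdiff (fun u hu => hGd u (hsub hu)) hza hzb hpos
    (hreg a (left_mem_Icc.2 (ham.trans hmb).le) ham.ne)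
    (hreg b (right_mem_Icc.2 (ham.trans hmb).le) hmb.ne'), ⟨⟨?_, ?_⟩, hk⟩, ?_,
    surrounds_levelOval hGc hza hzb ⟨ham, hmb⟩ (by simpa using hkm)⟩
  -- Beyond the endpoints of the oval `M` exceeds `k`, whereas `y² ≥ 0` gives `M x ≤ k`.
  · by_contra h
    push Not at h
    have := hAnti ⟨hx.1.le, h.le.trans ham.le⟩ ⟨hAa, ham.le⟩ h
    rw [hlevel a hza] at this
    exact (not_lt.2 hMx) this
  · by_contra h
    push Not at h
    have := hMono ⟨hmb.le, hbB⟩ ⟨hmb.le.trans h.le, hx.2.le⟩ h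
    rw [hlevel b hzb] at this
    exact (not_lt.2 hMx) this
  · rintro q ⟨hq1, hq2⟩
    refine ⟨⟨hAa'.trans_le hq1.1, hq1.2.trans_lt hbB'⟩, ?_⟩
    rw [hq2, hsign, hsign]
    exact mul_lt_mul_of_pos_right (by linarith) (hG _)

/-! ### Rotated family, central projection, and the final assembly. -/

/-- The planar systems form a rotated family with respect to `c₂`. -/
theorem isRotatedFamily_planarField {c1 c5 c7 : ℝ} (hc1 : c1 ≠ 0) (hc57 : 0 < c5 * c7) :
    IsRotatedFamily (fun c2 => planarField c1 c2 c5 c7) univ := by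
  have hs : 0 < c5 * (c5 + c7) := by nlinarith [mul_self_nonneg c5]
  refine ⟨isOpen_univ, ordConnected_univ, fun α _ β _ p => ?_, ?_, ?_⟩
  · rw [planarField_eq_zero_iff hc1 hc57, planarField_eq_zero_iff hc1 hc57]
  · simp only [fieldDet_planarField hc1]
    rcases lt_or_gt_of_ne hc1 with h | h
    · exact Or.inr fun α _ β _ hαβ p => mul_nonpos_of_nonpos_of_nonneg
        (div_nonpos_of_nonneg_of_nonpos hs.le h.le)
        (mul_nonneg (sub_pos.2 hαβ).le (by positivity))
    · exact Or.inl fun α _ β _ hαβ p => mul_nonneg (div_nonneg hs.le h.le)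
        (mul_nonneg (sub_pos.2 hαβ).le (by positivity))
  · intro α _ β _ hαβ Γ hΓ
    obtain ⟨c2, hc2⟩ : ∃ c2, IsPeriodicOrbit (planarField c1 c2 c5 c7) Γ :=
      hΓ.elim (fun h => ⟨α, h⟩) fun h => ⟨β, h⟩
    obtain ⟨γ, T, -, hγ, -, hne, rfl⟩ := hc2
    obtain ⟨t, ht⟩ := exists_snd_ne_zero hc1 hγ hne
    refine ⟨γ t, mem_range_self t, ?_⟩
    simp only [fieldDet_planarField hc1]
    exact mul_ne_zero (div_ne_zero hs.ne' hc1)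
      (mul_ne_zero (sub_pos.2 hαβ).ne' (mul_ne_zero (pow_ne_zero 2 ht) (by positivity)))

/-- Homogeneity explains the factor: the field scales with degree `2` and the derivative of the
projection with degree `-1`, so passing from `(u, v, -1)` to `-z (u, v, -1)` multiplies by `-z`. -/
lemma fderiv_centralProjection_sphereField {c1 : ℝ} (hc1 : c1 ≠ 0) (c2 c5 c7 : ℝ)
    {q : ℝ × ℝ × ℝ} (hz : q.2.2 < 0) :
    HasFDerivAt centralProjection (fderiv ℝ centralProjection q) q ∧
      fderiv ℝ centralProjection q (sphereField c1 c2 c5 c7 q)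
        = (-q.2.2) • planarField c1 c2 c5 c7 (centralProjection q) := by
  obtain ⟨x, y, z⟩ := q
  simp only at hz
  have hz' : z ≠ 0 := hz.ne
  have h1 : HasFDerivAt (fun q : ℝ × ℝ × ℝ => q.1)
    (ContinuousLinearMap.fst ℝ ℝ (ℝ × ℝ)) (x, y, z) := hasFDerivAt_fst
  have h2 : HasFDerivAt (fun q : ℝ × ℝ × ℝ => q.2.1)
    ((ContinuousLinearMap.fst ℝ ℝ ℝ).comp (ContinuousLinearMap.snd ℝ ℝ (ℝ × ℝ))) (x, y, z) :=
    hasFDerivAt_fst.comp _ hasFDerivAt_snd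
  have h3 : HasFDerivAt (fun q : ℝ × ℝ × ℝ => q.2.2)
    ((ContinuousLinearMap.snd ℝ ℝ ℝ).comp (ContinuousLinearMap.snd ℝ ℝ (ℝ × ℝ))) (x, y, z) :=
    hasFDerivAt_snd.comp _ hasFDerivAt_snd
  have hi := (hasDerivAt_inv (neg_ne_zero.2 hz')).comp_hasFDerivAt (x, y, z) h3.neg
  have h : HasFDerivAt centralProjection _ (x, y, z) := (h1.mul hi).prodMk (h2.mul hi)
  refine ⟨h.differentiableAt.hasFDerivAt, ?_⟩
  rw [h.fderiv]
  ext
  · simp [sphereField, planarField, centralProjection]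
    field_simp
    ring
  · simp [sphereField, planarField, centralProjection]
    field_simp
    ring

theorem mainTheorem9 (c1 c5 c7 : ℝ) (hc1 : c1 ≠ 0) (hc57 : 0 < c5 * c7) :
    -- the spatial field is tangent to the sphere
    (∀ c2 : ℝ, ∀ q ∈ unitSphere,
      q.1 * (sphereField c1 c2 c5 c7 q).1 + q.2.1 * (sphereField c1 c2 c5 c7 q).2.1
        + q.2.2 * (sphereField c1 c2 c5 c7 q).2.2 = 0) ∧
    -- the planar field is its image under central projection, up to the positive
    -- factor `-z` (a change of time)
    (∀ c2 : ℝ, ∀ q ∈ unitSphere, q.2.2 < 0 →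
      HasFDerivAt centralProjection (fderiv ℝ centralProjection q) q ∧
      fderiv ℝ centralProjection q (sphereField c1 c2 c5 c7 q)
        = (-q.2.2) • planarField c1 c2 c5 c7 (centralProjection q)) ∧
    -- no limit cycles
    (∀ c2 : ℝ, ¬ ∃ Γ, IsLimitCycle (planarField c1 c2 c5 c7) Γ) ∧
    -- rotated family with respect to `c₂ ∈ (-∞, ∞)`
    IsRotatedFamily (fun c2 => planarField c1 c2 c5 c7) univ ∧
    -- center for `c₂ = 0`
    IsCenter (planarField c1 0 c5 c7) (-c7 / c1, 0) := by
  refine ⟨fun c2 q _ => ?_, fun c2 q _ hz => fderiv_centralProjection_sphereField hc1 c2 c5 c7 hz,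
    fun c2 => ?_, isRotatedFamily_planarField hc1 hc57, isCenter_planarField_zero hc1 hc57⟩
  · simp only [sphereField]
    ring
  · rintro ⟨Γ, hΓ⟩
    rcases eq_or_ne c2 0 with rfl | hc2
    · exact not_isLimitCycle_planarField_zero hc1 hc57 Γ hΓ
    · exact not_isPeriodicOrbit_planarField hc1 hc57 hc2 Γ hΓ.1
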